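/- Let $D\in GL(2,\mathbb Z)$ be a hyperbolic automorphism of the torus $\mathbb R^2/\mathbb Z^2$ (no eigenvalue of modulus one). Choose linear coordinates $(x,y)$ on the plane whose horizontal axis is the stable direction and whose vertical axis is the unstable direction of $D$, so that in them $D=\mathrm{diag}(\mu,\lambda)$ with $|\mu|<1<|\lambda|$. Let $\mathcal F$ be the family of bases $\{e,f\}$ of the lattice $\mathbb Z^2$ such that, in these coordinates, $e$ lies in the open first quadrant and $f$ in the open second quadrant. Fix $\{e_0,f_0\}\in\mathcal F$ and define $\{e_n,f_n\}\in\mathcal F$, $n\in\mathbb Z$, as follows. Forward: $\{e_{n+1},f_{n+1}\}=\{e_n+f_n,f_n\}$ if $e_n+f_n$ lies in the right half-plane, and $\{e_n,e_n+f_n\}$ if it lies in the left half-plane. Backward: $\{e_{n-1},f_{n-1}\}=\{e_n-f_n,f_n\}$ if $e_n-f_n$ lies in the upper half-plane, and $\{e_n,f_n-e_n\}$ if $f_n-e_n$ does. The cutting sequence is $s_n=0$ if $e_{n+1}=e_n$ and $s_n=1$ if $f_{n+1}=f_n$ ($n\in\mathbb Z$). An integer $N\ge 1$ is a period of it if $s_{k+N}=s_k$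 for all $k\in\mathbb Z$, and a semi-period if $s_{k+N}=1-s_k$ for all $k\in\mathbb Z$; the smallest one is called basic. Then the cutting sequence is periodic. Let $N$ be its basic semi-period if it has a semi-period, and its basic period otherwise. There is a unique $G\in GL(2,\mathbb Z)$ with $G e_0=f_N$, $G f_0=e_N$ in the case of the semi-period, respectively with $G e_0=e_N$, $G f_0=f_N$ in the case of the period. It maps the vertical axis onto itself and the horizontal axis onto itself, and there is an integer $K\ge 1$ such that $G^K=D$ or $G^K=-D$. Moreover, the centralizer of $D$ in $GL(2,\mathbb Z)$ is equal to $\{\pm G^k : k\in\mathbb Z\}$. -/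

import Mathlib

namespace ToralBiFan

/-- The linear map of `ℝ²` given by an element of `GL(2,ℤ)`; it descends to the corresponding
automorphism of the torus `ℝ²/ℤ²`. -/
noncomputable def realMap (A : Matrix.GeneralLinearGroup (Fin 2) ℤ) :
    (Fin 2 → ℝ) →ₗ[ℝ] (Fin 2 → ℝ) :=
  Matrix.toLin' ((A : Matrix (Fin 2) (Fin 2) ℤ).map (fun m : ℤ => (m : ℝ)))

/-- A toral automorphism is hyperbolic if it has no (complex) eigenvalue of modulus one. -/
def IsHyperbolic (A : Matrix.GeneralLinearGroup (Fin 2) ℤ) : Prop :=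
  ∀ z ∈ spectrum ℂ ((A : Matrix (Fin 2) (Fin 2) ℤ).map (fun m : ℤ => (m : ℂ))), ‖z‖ ≠ 1

/-- Linear coordinates `(x, y)` on the plane whose horizontal axis is the stable direction of `D`
and whose vertical axis is the unstable direction: in these coordinates `D` is the diagonal matrix
`diag(μ, lam)` with `|μ| < 1 < |lam|`. -/
def IsAdapted (D : Matrix.GeneralLinearGroup (Fin 2) ℤ) (φ : (Fin 2 → ℝ) ≃ₗ[ℝ] ℝ × ℝ) : Prop :=
  ∃ μ lam : ℝ, |μ| < 1 ∧ 1 < |lam| ∧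
    ∀ v : Fin 2 → ℝ, φ (realMap D v) = (μ * (φ v).1, lam * (φ v).2)

/-- The line `y = 0`. -/
noncomputable def horizontalAxis (φ : (Fin 2 → ℝ) ≃ₗ[ℝ] ℝ × ℝ) : Submodule ℝ (Fin 2 → ℝ) :=
  LinearMap.ker (LinearMap.snd ℝ ℝ ℝ ∘ₗ φ.toLinearMap)

/-- The line `x = 0`. -/
noncomputable def verticalAxis (φ : (Fin 2 → ℝ) ≃ₗ[ℝ] ℝ × ℝ) : Submodule ℝ (Fin 2 → ℝ) :=
  LinearMap.ker (LinearMap.fst ℝ ℝ ℝ ∘ₗ φ.toLinearMap)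

/-- Both axes are mapped onto themselves. -/
def PreservesAxes (φ : (Fin 2 → ℝ) ≃ₗ[ℝ] ℝ × ℝ) (A : Matrix.GeneralLinearGroup (Fin 2) ℤ) : Prop :=
  (verticalAxis φ).map (realMap A) = verticalAxis φ ∧
    (horizontalAxis φ).map (realMap A) = horizontalAxis φ

/-- Horizontal coordinate of a lattice vector. -/
noncomputable def xCoord (φ : (Fin 2 → ℝ) ≃ₗ[ℝ] ℝ × ℝ) (v : Fin 2 → ℤ) : ℝ :=
  (φ (fun i => (v i : ℝ))).1

/-- Vertical coordinate of a lattice vector. -/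
noncomputable def yCoord (φ : (Fin 2 → ℝ) ≃ₗ[ℝ] ℝ × ℝ) (v : Fin 2 → ℤ) : ℝ :=
  (φ (fun i => (v i : ℝ))).2

/-- Membership in the bi-fan: `(e, f)` is a basis of the lattice, with `e` in the open first
quadrant and `f` in the open second quadrant. -/
def MemBiFan (φ : (Fin 2 → ℝ) ≃ₗ[ℝ] ℝ × ℝ) (e f : Fin 2 → ℤ) : Prop :=
  LinearIndependent ℤ ![e, f] ∧ Submodule.span ℤ {e, f} = ⊤ ∧
    (0 < xCoord φ e ∧ 0 < yCoord φ e) ∧ (xCoord φ f < 0 ∧ 0 < yCoord φ f)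

/-- One step of the cutting algorithm: `e + f` replaces `e` if it lies in the right half-plane,
and `f` otherwise. -/
noncomputable def cutForward (φ : (Fin 2 → ℝ) ≃ₗ[ℝ] ℝ × ℝ)
    (p : (Fin 2 → ℤ) × (Fin 2 → ℤ)) : (Fin 2 → ℤ) × (Fin 2 → ℤ) :=
  if 0 < xCoord φ (p.1 + p.2) then (p.1 + p.2, p.2) else (p.1, p.1 + p.2)

/-- One backward step. If `e - f` is in the upper half-plane (it is then in the first quadrant) it
replaces `e`; otherwise `f - e` is in the upper half-plane (and in the second quadrant) and it
replaces `f`. -/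
noncomputable def cutBackward (φ : (Fin 2 → ℝ) ≃ₗ[ℝ] ℝ × ℝ)
    (p : (Fin 2 → ℤ) × (Fin 2 → ℤ)) : (Fin 2 → ℤ) × (Fin 2 → ℤ) :=
  if 0 < yCoord φ (p.1 - p.2) then (p.1 - p.2, p.2) else (p.1, p.2 - p.1)

/-- The two-sided sequence of bases `(e_n, f_n)` produced from `(e_0, f_0)`. -/
noncomputable def bases (φ : (Fin 2 → ℝ) ≃ₗ[ℝ] ℝ × ℝ) (e₀ f₀ : Fin 2 → ℤ) :
    ℤ → (Fin 2 → ℤ) × (Fin 2 → ℤ)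
  | Int.ofNat n => (cutForward φ)^[n] (e₀, f₀)
  | Int.negSucc n => (cutBackward φ)^[n + 1] (e₀, f₀)

/-- The cutting sequence: `s_n = 0` if `e_{n+1} = e_n`, and `s_n = 1` if not, that is, if
`f_{n+1} = f_n` (exactly one of the two vectors changes at each step). -/
noncomputable def cuttingSeq (φ : (Fin 2 → ℝ) ≃ₗ[ℝ] ℝ × ℝ) (e₀ f₀ : Fin 2 → ℤ) (n : ℤ) : ℤ :=
  if (bases φ e₀ f₀ (n + 1)).1 = (bases φ e₀ f₀ n).1 then 0 else 1

def IsPeriod (s : ℤ → ℤ) (N : ℕ) : Prop := 0 < N ∧ ∀ k : ℤ, s (k + N) = s k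

def IsSemiPeriod (s : ℤ → ℤ) (N : ℕ) : Prop := 0 < N ∧ ∀ k : ℤ, s (k + N) = 1 - s k

def IsBasicPeriod (s : ℤ → ℤ) (N : ℕ) : Prop := IsLeast {n | IsPeriod s n} N

def IsBasicSemiPeriod (s : ℤ → ℤ) (N : ℕ) : Prop := IsLeast {n | IsSemiPeriod s n} N

/-- `G` preserves both axes, `G ^ K = ± D` for some natural number `K ≥ 1`, and the centralizer of
`D` in `GL(2,ℤ)` is `{± G ^ k | k ∈ ℤ}`. -/
def IsGeneratorOf (φ : (Fin 2 → ℝ) ≃ₗ[ℝ] ℝ × ℝ) (D G : Matrix.GeneralLinearGroup (Fin 2) ℤ) :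
    Prop :=
  PreservesAxes φ G ∧
    (∃ K : ℕ, 0 < K ∧ (G ^ K = D ∨ G ^ K = -D)) ∧
    (Subgroup.centralizer {D} : Set (Matrix.GeneralLinearGroup (Fin 2) ℤ)) =
      {A | ∃ k : ℤ, A = G ^ k ∨ A = -G ^ k}

end ToralBiFan

namespace ToralBiFan

open Matrix

variable {φ : (Fin 2 → ℝ) ≃ₗ[ℝ] ℝ × ℝ}

/-! ### Coordinates of lattice vectors -/

/-! The bi-fan is a copy of `ℤ` on which symmetries act by translation. The axes contain no nonzero
lattice vector (`IsDiag.irrational`), so cutting forward and cutting backward are inverse bijections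
of the bi-fan. They have a single orbit (`IsDiag.exists_bases_eq`): a high power of `D ^ 2` carries
any basis into the cone of any other, and Euclid's algorithm then joins the two by cuts.

An automorphism that is diagonal in the coordinates with positive vertical eigenvalue preserves the
bi-fan, up to exchanging the two vectors if the horizontal eigenvalue is negative, and it commutes
with cutting. Hence it shifts the sequence of bases (`IsDiag.exists_shifts`), and the cutting
sequence is invariant under that shift, up to exchanging the symbols. Conversely, each such
invariance of the cutting sequence comes from an automorphism (`SeqShifts.shifts`). This
automorphism commutes with `D ^ 2`, because the amount of a shift determines the automorphism, and
so it is diagonal (`Shifts.isDiag`).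

The admissible shifts form a subgroup of `ℤ`, generated by the basic semi-period or, failing that,
the basic period; `G` realizes the generator. The centralizer of `D` consists of the diagonal
automorphisms, each of which is, up to sign, one of these shifts. -/

theorem xCoord_add (v w : Fin 2 → ℤ) : xCoord φ (v + w) = xCoord φ v + xCoord φ w := by
  have : (fun i => ((v + w) i : ℝ)) = (fun i => (v i : ℝ)) + fun i => (w i : ℝ) := by
    ext i; simp
  simp only [xCoord, this, map_add, Prod.fst_add]

theorem yCoord_add (v w : Fin 2 → ℤ) : yCoord φ (v + w) = yCoord φ v + yCoord φ w := by
  have : (fun i => ((v + w) i : ℝ)) = (fun i => (v i : ℝ)) + fun i => (w i : ℝ) := by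
    ext i; simp
  simp only [yCoord, this, map_add, Prod.snd_add]

theorem xCoord_smul (c : ℤ) (v : Fin 2 → ℤ) : xCoord φ (c • v) = c * xCoord φ v := by
  have : (fun i => ((c • v) i : ℝ)) = (c : ℝ) • fun i => (v i : ℝ) := by
    ext i; simp
  simp only [xCoord, this, map_smul, Prod.smul_fst, smul_eq_mul]

theorem yCoord_smul (c : ℤ) (v : Fin 2 → ℤ) : yCoord φ (c • v) = c * yCoord φ v := by
  have : (fun i => ((c • v) i : ℝ)) = (c : ℝ) • fun i => (v i : ℝ) := by
    ext i; simp
  simp only [yCoord, this, map_smul, Prod.smul_snd, smul_eq_mul]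

theorem xCoord_sub (v w : Fin 2 → ℤ) : xCoord φ (v - w) = xCoord φ v - xCoord φ w := by
  rw [eq_sub_iff_add_eq, ← xCoord_add, sub_add_cancel]

theorem yCoord_sub (v w : Fin 2 → ℤ) : yCoord φ (v - w) = yCoord φ v - yCoord φ w := by
  rw [eq_sub_iff_add_eq, ← yCoord_add, sub_add_cancel]

theorem xCoord_zero : xCoord φ 0 = 0 := by
  simpa using xCoord_smul (φ := φ) 0 0

theorem yCoord_zero : yCoord φ 0 = 0 := by
  simpa using yCoord_smul (φ := φ) 0 0

/-! ### Automorphisms that are diagonal in the coordinates -/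

/-- `A` is `diag(α, β)` in the coordinates `φ`. -/
def IsDiag (φ : (Fin 2 → ℝ) ≃ₗ[ℝ] ℝ × ℝ) (A : GeneralLinearGroup (Fin 2) ℤ) (α β : ℝ) : Prop :=
  ∀ v : Fin 2 → ℝ, φ (realMap A v) = (α * (φ v).1, β * (φ v).2)

variable {A B : GeneralLinearGroup (Fin 2) ℤ} {α β γ δ : ℝ}

theorem realMap_mul (A B : GeneralLinearGroup (Fin 2) ℤ) (v : Fin 2 → ℝ) :
    realMap (A * B) v = realMap A (realMap B v) := by
  have h : ((A * B : GeneralLinearGroup (Fin 2) ℤ) : Matrix (Fin 2) (Fin 2) ℤ).map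
      (fun m : ℤ => (m : ℝ)) = (A : Matrix (Fin 2) (Fin 2) ℤ).map (fun m : ℤ => (m : ℝ)) *
        (B : Matrix (Fin 2) (Fin 2) ℤ).map (fun m : ℤ => (m : ℝ)) := by
    ext i j; simp [Matrix.mul_apply]
  simp only [realMap, h, Matrix.toLin'_mul, LinearMap.comp_apply]

theorem realMap_one (v : Fin 2 → ℝ) : realMap 1 v = v := by
  have h : ((1 : GeneralLinearGroup (Fin 2) ℤ) : Matrix (Fin 2) (Fin 2) ℤ).map
      (fun m : ℤ => (m : ℝ)) = 1 := by
    ext i j; simp [Matrix.one_apply]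
  rw [realMap, h, Matrix.toLin'_one, LinearMap.id_apply]

theorem realMap_neg (A : GeneralLinearGroup (Fin 2) ℤ) (v : Fin 2 → ℝ) :
    realMap (-A) v = -realMap A v := by
  have h : ((-A : GeneralLinearGroup (Fin 2) ℤ) : Matrix (Fin 2) (Fin 2) ℤ).map
      (fun m : ℤ => (m : ℝ)) = -(A : Matrix (Fin 2) (Fin 2) ℤ).map (fun m : ℤ => (m : ℝ)) := by
    ext i j; simp
  rw [realMap, h, map_neg, LinearMap.neg_apply, realMap]

theorem realMap_intCast (A : GeneralLinearGroup (Fin 2) ℤ) (v : Fin 2 → ℤ) :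
    realMap A (fun i => (v i : ℝ)) = fun i => ((A.1.mulVec v) i : ℝ) := by
  ext i; simp [realMap, Matrix.mulVec, dotProduct]

theorem realMap_inv_apply (A : GeneralLinearGroup (Fin 2) ℤ) (v : Fin 2 → ℝ) :
    realMap A (realMap A⁻¹ v) = v := by
  rw [← realMap_mul, mul_inv_cancel, realMap_one]

theorem IsDiag.xCoord_mulVec (h : IsDiag φ A α β) (v : Fin 2 → ℤ) :
    xCoord φ (A.1.mulVec v) = α * xCoord φ v := by
  simp only [xCoord, ← realMap_intCast, h _]

theorem IsDiag.yCoord_mulVec (h : IsDiag φ A α β) (v : Fin 2 → ℤ) :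
    yCoord φ (A.1.mulVec v) = β * yCoord φ v := by
  simp only [yCoord, ← realMap_intCast, h _]

theorem IsDiag.mul (hA : IsDiag φ A α β) (hB : IsDiag φ B γ δ) :
    IsDiag φ (A * B) (α * γ) (β * δ) := fun v => by
  rw [realMap_mul, hA, hB]; simp [mul_assoc]

theorem IsDiag.neg (hA : IsDiag φ A α β) : IsDiag φ (-A) (-α) (-β) := fun v => by
  rw [realMap_neg, map_neg, hA]; simp

theorem IsDiag.pow (hA : IsDiag φ A α β) (n : ℕ) : IsDiag φ (A ^ n) (α ^ n) (β ^ n) := by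
  induction n with
  | zero => intro v; simp [realMap_one]
  | succ n ih => simpa [pow_succ] using ih.mul hA

theorem IsDiag.ne_zero (hA : IsDiag φ A α β) : α ≠ 0 ∧ β ≠ 0 := by
  have h := hA (realMap A⁻¹ (φ.symm (1, 1)))
  rw [realMap_inv_apply, LinearEquiv.apply_symm_apply, Prod.mk.injEq] at h
  exact ⟨fun h0 => by simp [h0] at h, fun h0 => by simp [h0] at h⟩

theorem IsDiag.inv (hA : IsDiag φ A α β) : IsDiag φ A⁻¹ α⁻¹ β⁻¹ := fun v => by
  obtain ⟨hα, hβ⟩ := hA.ne_zero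
  have h := hA (realMap A⁻¹ v)
  rw [realMap_inv_apply] at h
  rw [h]
  ext <;> simp [hα, hβ]

theorem IsDiag.preservesAxes (hA : IsDiag φ A α β) : PreservesAxes φ A := by
  have hB := hA.inv
  constructor
  · ext v
    simp only [verticalAxis, Submodule.mem_map, LinearMap.mem_ker, LinearMap.comp_apply,
      LinearEquiv.coe_coe, LinearMap.fst_apply]
    exact ⟨by rintro ⟨w, hw, rfl⟩; simp [hA w, hw],
      fun hv => ⟨realMap A⁻¹ v, by simp [hB v, hv], realMap_inv_apply A v⟩⟩
  · ext v
    simp only [horizontalAxis, Submodule.mem_map, LinearMap.mem_ker, LinearMap.comp_apply,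
      LinearEquiv.coe_coe, LinearMap.snd_apply]
    exact ⟨by rintro ⟨w, hw, rfl⟩; simp [hA w, hw],
      fun hv => ⟨realMap A⁻¹ v, by simp [hB v, hv], realMap_inv_apply A v⟩⟩

/-- An automorphism commuting with a diagonal one with distinct eigenvalues is diagonal. -/
theorem IsDiag.of_commute (hA : IsDiag φ A α β) (hne : α ≠ β) (hc : A * B = B * A) :
    ∃ γ δ, IsDiag φ B γ δ := by
  have key : ∀ v, φ (realMap B (realMap A v)) =
      (α * (φ (realMap B v)).1, β * (φ (realMap B v)).2) := fun v => by
    rw [← realMap_mul, ← hc, realMap_mul, hA]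
  set u := φ.symm (1, 0) with hu
  set w := φ.symm (0, 1) with hw
  have hAu : realMap A u = α • u := φ.injective (by rw [hA]; simp [hu])
  have hAw : realMap A w = β • w := φ.injective (by rw [hA]; simp [hw])
  have h1 := key u
  have h2 := key w
  rw [hAu, map_smul, map_smul] at h1
  rw [hAw, map_smul, map_smul] at h2
  have h1' : (φ (realMap B u)).2 = 0 := by
    have := congrArg Prod.snd h1
    simp only [Prod.smul_snd, smul_eq_mul] at this
    exact (mul_eq_mul_right_iff.1 this).resolve_left hne
  have h2' : (φ (realMap B w)).1 = 0 := by
    have := congrArg Prod.fst h2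
    simp only [Prod.smul_fst, smul_eq_mul] at this
    exact (mul_eq_mul_right_iff.1 this).resolve_left hne.symm
  refine ⟨(φ (realMap B u)).1, (φ (realMap B w)).2, fun v => ?_⟩
  have hv : v = (φ v).1 • u + (φ v).2 • w := φ.injective (by simp [hu, hw])
  conv_lhs => rw [hv]
  simp only [map_add, map_smul]
  ext <;> simp [h1', h2', mul_comm]

/-! ### Irrationality of the axes -/

theorem mulVec_eq_zero_iff (A : GeneralLinearGroup (Fin 2) ℤ) (v : Fin 2 → ℤ) :
    A.1.mulVec v = 0 ↔ v = 0 := by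
  refine ⟨fun h => ?_, fun h => by simp [h]⟩
  have : A⁻¹.1.mulVec (A.1.mulVec v) = v := by
    rw [Matrix.mulVec_mulVec, ← Units.val_mul, inv_mul_cancel]; simp
  rw [← this, h, Matrix.mulVec_zero]

/-- An automorphism of the lattice has no lattice eigenvector with an eigenvalue of modulus less
than one. -/
theorem eq_zero_of_realMap_eq_smul {c : ℝ} (hc : |c| < 1) (v : Fin 2 → ℤ)
    (hv : realMap A (fun i => (v i : ℝ)) = c • fun i => (v i : ℝ)) : v = 0 := by
  induction hn : ∑ i, (v i).natAbs using Nat.strong_induction_on generalizing v with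
  | _ n ih =>
    by_contra h0
    obtain ⟨i, hi⟩ : ∃ i, v i ≠ 0 := by
      by_contra! h
      exact h0 (funext h)
    have hco : ∀ i, ((A.1.mulVec v) i : ℝ) = c * v i := fun i => by
      simpa [realMap_intCast] using congrFun hv i
    have hle : ∀ i, (((A.1.mulVec v) i).natAbs : ℝ) = |c| * ((v i).natAbs : ℝ) := fun i => by
      rw [Nat.cast_natAbs, Nat.cast_natAbs, Int.cast_abs, Int.cast_abs, hco, abs_mul]
    -- Descent on the sum of absolute values of the entries: `A v` is an integral eigenvector for
    -- the same `c`, and it is strictly smaller.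
    refine h0 ((mulVec_eq_zero_iff A v).1 (ih _ ?_ _ ?_ rfl))
    · rw [← hn]
      refine Finset.sum_lt_sum (fun j _ => ?_) ⟨i, Finset.mem_univ _, ?_⟩
      · have : (((A.1.mulVec v) j).natAbs : ℝ) ≤ ((v j).natAbs : ℝ) := by
          rw [hle]; exact mul_le_of_le_one_left (by positivity) hc.le
        exact_mod_cast this
      · have : (((A.1.mulVec v) i).natAbs : ℝ) < ((v i).natAbs : ℝ) := by
          rw [hle]
          exact mul_lt_of_lt_one_left (by exact_mod_cast Int.natAbs_pos.2 hi) hc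
        exact_mod_cast this
    · rw [← realMap_intCast, hv, map_smul, hv]

/-- The axes contain no nonzero lattice vector. -/
def Irrational (φ : (Fin 2 → ℝ) ≃ₗ[ℝ] ℝ × ℝ) : Prop :=
  (∀ v, xCoord φ v = 0 → v = 0) ∧ ∀ v, yCoord φ v = 0 → v = 0

/-- A lattice vector on the vertical axis is an eigenvector of `A⁻¹` for `β⁻¹`, one on the
horizontal axis an eigenvector of `A` for `α`; both eigenvalues have modulus less than one. -/
theorem IsDiag.irrational (hA : IsDiag φ A α β) (hα : |α| < 1) (hβ : 1 < |β|) : Irrational φ := by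
  constructor
  · intro v hv
    refine eq_zero_of_realMap_eq_smul (A := A⁻¹) (c := β⁻¹)
      (by rw [abs_inv]; exact inv_lt_one_of_one_lt₀ hβ) v (φ.injective ?_)
    rw [hA.inv, map_smul]
    unfold xCoord at hv
    ext <;> simp [hv]
  · intro v hv
    refine eq_zero_of_realMap_eq_smul (A := A) hα v (φ.injective ?_)
    rw [hA, map_smul]
    unfold yCoord at hv
    ext <;> simp [hv]

theorem GL_ext (h : ∀ v : Fin 2 → ℤ, A.1.mulVec v = B.1.mulVec v) : A = B :=
  Units.ext (Matrix.ext_of_mulVec_single fun _ => h _)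

/-- By irrationality a lattice vector is determined by its horizontal coordinate alone, so it
suffices to compare these. -/
theorem IsDiag.commute (hφ : Irrational φ) (hA : IsDiag φ A α β) (hB : IsDiag φ B γ δ) :
    A * B = B * A := GL_ext fun v => by
  rw [← sub_eq_zero]
  apply hφ.1
  rw [xCoord_sub, (hA.mul hB).xCoord_mulVec, (hB.mul hA).xCoord_mulVec]
  ring

/-! ### The bi-fan and the cutting algorithm -/

/-- The determinant of a pair of lattice vectors. -/
def pairDet (p : (Fin 2 → ℤ) × (Fin 2 → ℤ)) : ℤ := p.1 0 * p.2 1 - p.1 1 * p.2 0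

/-- Membership in the bi-fan, with the basis property expressed by the determinant. -/
def InFan (φ : (Fin 2 → ℝ) ≃ₗ[ℝ] ℝ × ℝ) (p : (Fin 2 → ℤ) × (Fin 2 → ℤ)) : Prop :=
  IsUnit (pairDet p) ∧ 0 < xCoord φ p.1 ∧ 0 < yCoord φ p.1 ∧ xCoord φ p.2 < 0 ∧ 0 < yCoord φ p.2

theorem MemBiFan.inFan {e f : Fin 2 → ℤ} (h : MemBiFan φ e f) : InFan φ (e, f) := by
  obtain ⟨-, hs, h1, h2⟩ := h
  refine ⟨?_, h1.1, h1.2, h2.1, h2.2⟩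
  have hm : ∀ v : Fin 2 → ℤ, ∃ a b : ℤ, a • e + b • f = v := fun v =>
    Submodule.mem_span_pair.1 (hs ▸ Submodule.mem_top)
  obtain ⟨a, b, hab⟩ := hm ![1, 0]
  obtain ⟨c, d, hcd⟩ := hm ![0, 1]
  have e1 := congrFun hab 0
  have e2 := congrFun hab 1
  have e3 := congrFun hcd 0
  have e4 := congrFun hcd 1
  simp at e1 e2 e3 e4
  refine IsUnit.of_mul_eq_one (a * d - b * c) ?_
  simp only [pairDet]
  linear_combination (c * e 1 + d * f 1) * e1 + e4 - (c * e 0 + d * f 0) * e2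

/-- Cramer's rule; a determinant `±1` is its own inverse. -/
theorem exists_coords {p : (Fin 2 → ℤ) × (Fin 2 → ℤ)} (h : IsUnit (pairDet p)) (v : Fin 2 → ℤ) :
    ∃ a b : ℤ, v = a • p.1 + b • p.2 := by
  have hd : pairDet p * pairDet p = 1 := by
    rcases Int.isUnit_iff.1 h with h | h <;> simp [h]
  refine ⟨pairDet p * (v 0 * p.2 1 - v 1 * p.2 0), pairDet p * (p.1 0 * v 1 - p.1 1 * v 0), ?_⟩
  ext i
  fin_cases i
  · simp only [pairDet] at *
    simp
    linear_combination (-v 0) * hd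
  · simp only [pairDet] at *
    simp
    linear_combination (-v 1) * hd

variable {p q : (Fin 2 → ℤ) × (Fin 2 → ℤ)}

/-- Irrationality keeps the sum off the vertical axis, so it lies in one of the two open quadrants.
-/
theorem InFan.cutForward (hφ : Irrational φ) (hp : InFan φ p) : InFan φ (cutForward φ p) := by
  obtain ⟨hd, h1, h2, h3, h4⟩ := hp
  have hy : 0 < yCoord φ (p.1 + p.2) := by rw [yCoord_add]; positivity
  have hx : xCoord φ (p.1 + p.2) ≠ 0 := fun h => by
    rw [hφ.1 _ h, yCoord_zero] at hy; exact hy.false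
  unfold ToralBiFan.cutForward
  split_ifs with h
  · refine ⟨?_, h, hy, h3, h4⟩
    convert hd using 1; simp [pairDet]; ring
  · refine ⟨?_, h1, h2, lt_of_le_of_ne (not_lt.1 h) hx, hy⟩
    convert hd using 1; simp [pairDet]; ring

theorem InFan.cutBackward (hφ : Irrational φ) (hp : InFan φ p) : InFan φ (cutBackward φ p) := by
  obtain ⟨hd, h1, h2, h3, h4⟩ := hp
  have hx : 0 < xCoord φ (p.1 - p.2) := by rw [xCoord_sub]; linarith
  have hy : yCoord φ (p.1 - p.2) ≠ 0 := fun h => by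
    rw [hφ.2 _ h, xCoord_zero] at hx; exact hx.false
  unfold ToralBiFan.cutBackward
  split_ifs with h
  · refine ⟨?_, hx, h, h3, h4⟩
    convert hd using 1; simp [pairDet]; ring
  · have h' := lt_of_le_of_ne (not_lt.1 h) hy
    rw [yCoord_sub] at h'
    rw [xCoord_sub] at hx
    refine ⟨?_, h1, h2, ?_, ?_⟩
    · convert hd using 1; simp [pairDet]; ring
    · simp only [xCoord_sub]; linarith
    · simp only [yCoord_sub]; linarith

theorem cutForward_cutBackward (hp : InFan φ p) : cutForward φ (cutBackward φ p) = p := by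
  obtain ⟨-, h1, -, h3, -⟩ := hp
  unfold cutForward cutBackward
  split_ifs with h h' h'
  · simp
  · simp [h1] at h'
  · simp [h3.le, not_lt.2] at h'
  · simp

theorem cutBackward_cutForward (hp : InFan φ p) : cutBackward φ (cutForward φ p) = p := by
  obtain ⟨-, -, h2, -, h4⟩ := hp
  unfold cutForward cutBackward
  split_ifs with h h' h'
  · simp
  · simp [h2] at h'
  · rw [yCoord_sub, yCoord_add] at h'; linarith
  · simp

theorem cutForward_inj (hp : InFan φ p) (hq : InFan φ q) (h : cutForward φ p = cutForward φ q) :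
    p = q := by
  rw [← cutBackward_cutForward hp, h, cutBackward_cutForward hq]

theorem InFan.iterate_cutForward (hφ : Irrational φ) (hp : InFan φ p) (n : ℕ) :
    InFan φ ((ToralBiFan.cutForward φ)^[n] p) := by
  induction n with
  | zero => exact hp
  | succ n ih => rw [Function.iterate_succ_apply']; exact ih.cutForward hφ

theorem InFan.iterate_cutBackward (hφ : Irrational φ) (hp : InFan φ p) (n : ℕ) :
    InFan φ ((ToralBiFan.cutBackward φ)^[n] p) := by
  induction n with
  | zero => exact hp
  | succ n ih => rw [Function.iterate_succ_apply']; exact ih.cutBackward hφ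

theorem iterate_cutForward_inj (hφ : Irrational φ) (hp : InFan φ p) (hq : InFan φ q) (n : ℕ)
    (h : (cutForward φ)^[n] p = (cutForward φ)^[n] q) : p = q := by
  induction n with
  | zero => exact h
  | succ n ih =>
    rw [Function.iterate_succ_apply', Function.iterate_succ_apply'] at h
    exact ih (cutForward_inj (hp.iterate_cutForward hφ n) (hq.iterate_cutForward hφ n) h)

variable {e₀ f₀ : Fin 2 → ℤ}

theorem bases_zero : bases φ e₀ f₀ 0 = (e₀, f₀) := rfl

theorem inFan_bases (hφ : Irrational φ) (h₀ : InFan φ (e₀, f₀)) (n : ℤ) :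
    InFan φ (bases φ e₀ f₀ n) := by
  cases n with
  | ofNat n => exact h₀.iterate_cutForward hφ n
  | negSucc n => exact h₀.iterate_cutBackward hφ (n + 1)

theorem bases_succ (hφ : Irrational φ) (h₀ : InFan φ (e₀, f₀)) (n : ℤ) :
    bases φ e₀ f₀ (n + 1) = cutForward φ (bases φ e₀ f₀ n) := by
  cases n with
  | ofNat n => exact Function.iterate_succ_apply' _ _ _
  | negSucc n =>
    have h1 : bases φ e₀ f₀ (Int.negSucc n + 1) = (cutBackward φ)^[n] (e₀, f₀) := by
      cases n with
      | zero => rfl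
      | succ n => rfl
    have h2 : bases φ e₀ f₀ (Int.negSucc n) =
        cutBackward φ ((cutBackward φ)^[n] (e₀, f₀)) := Function.iterate_succ_apply' _ _ _
    rw [h1, h2, cutForward_cutBackward (h₀.iterate_cutBackward hφ n)]

theorem bases_add_nat (hφ : Irrational φ) (h₀ : InFan φ (e₀, f₀)) (n : ℤ) (k : ℕ) :
    bases φ e₀ f₀ (n + k) = (cutForward φ)^[k] (bases φ e₀ f₀ n) := by
  induction k with
  | zero => simp
  | succ k ih =>
    rw [Function.iterate_succ_apply', ← ih, ← bases_succ hφ h₀]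
    congr 1; push_cast; ring

/-- The height of the bases grows along the sequence. -/
theorem strictMono_height (hφ : Irrational φ) (h₀ : InFan φ (e₀, f₀)) :
    StrictMono fun n : ℤ => yCoord φ (bases φ e₀ f₀ n).1 + yCoord φ (bases φ e₀ f₀ n).2 := by
  refine strictMono_int_of_lt_succ fun n => ?_
  obtain ⟨-, -, h2, -, h4⟩ := inFan_bases hφ h₀ n
  rw [bases_succ hφ h₀]
  unfold cutForward
  split_ifs <;> simp only [yCoord_add] <;> linarith

/-! ### The bi-fan is a single orbit of the cutting algorithm -/

/-- Euclid's algorithm: a basis of the bi-fan which lies in the cone of another one is obtained from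
it by cutting. -/
theorem exists_iterate_of_coords_nonneg (hp : InFan φ p) (a b c d : ℤ) (ha : 0 ≤ a) (hb : 0 ≤ b)
    (hc : 0 ≤ c) (hd : 0 ≤ d) (hq : InFan φ (a • p.1 + b • p.2, c • p.1 + d • p.2)) :
    ∃ k : ℕ, (cutForward φ)^[k] p = (a • p.1 + b • p.2, c • p.1 + d • p.2) := by
  induction hn : (a + b + c + d).toNat using Nat.strong_induction_on generalizing a b c d with
  | _ n ih =>
    obtain ⟨hpd, hp1, hp2, hp3, hp4⟩ := hp
    obtain ⟨hqd, hq1, hq2, hq3, hq4⟩ := hq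
    simp only [xCoord_add, xCoord_smul, yCoord_add, yCoord_smul] at hq1 hq2 hq3 hq4
    -- Both bases are positively oriented in the coordinates, so the transition determinant is
    -- positive; being a unit, it equals `1`.
    have hdet : 0 < a * d - b * c := by
      have h1 : 0 < ((a * d - b * c : ℤ) : ℝ) *
          (xCoord φ p.1 * yCoord φ p.2 - xCoord φ p.2 * yCoord φ p.1) := by
        push_cast
        nlinarith [mul_pos hq1 hq4, mul_pos (neg_pos.2 hq3) hq2]
      have h2 : 0 < xCoord φ p.1 * yCoord φ p.2 - xCoord φ p.2 * yCoord φ p.1 := by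
        nlinarith [mul_pos hp1 hp4, mul_pos (neg_pos.2 hp3) hp2]
      exact_mod_cast (pos_iff_pos_of_mul_pos h1).2 h2
    have hdet1 : a * d - b * c = 1 := by
      have : pairDet (a • p.1 + b • p.2, c • p.1 + d • p.2) = (a * d - b * c) * pairDet p := by
        simp [pairDet]; ring
      rw [this, IsUnit.mul_iff] at hqd
      rcases Int.isUnit_iff.1 hqd.1 with h | h <;> omega
    have hab : 0 < a + b := by
      by_contra h
      have h1 : a = 0 := by omega
      have h2 : b = 0 := by omega
      simp [h1, h2] at hdet
    have hcd : 0 < c + d := by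
      by_contra h
      have h1 : c = 0 := by omega
      have h2 : d = 0 := by omega
      simp [h1, h2] at hdet
    have hunit : ∀ q, pairDet q = pairDet (a • p.1 + b • p.2, c • p.1 + d • p.2) →
        IsUnit (pairDet q) := fun q h => h ▸ hqd
    -- The first vector dominates the second, so the last cut replaced the first vector; subtracting
    -- undoes it and lowers the sum of the coefficients.
    by_cases h1 : c ≤ a ∧ d ≤ b
    · have hca : (0 : ℝ) ≤ ((a - c : ℤ) : ℝ) := by exact_mod_cast (by omega : 0 ≤ a - c)
      have hdb : (0 : ℝ) ≤ ((b - d : ℤ) : ℝ) := by exact_mod_cast (by omega : 0 ≤ b - d)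
      have hy : 0 < ((a - c : ℤ) : ℝ) * yCoord φ p.1 + ((b - d : ℤ) : ℝ) * yCoord φ p.2 := by
        rcases hca.lt_or_eq with h | h
        · positivity
        rcases hdb.lt_or_eq with h' | h'
        · positivity
        have h3 : a - c = 0 := by exact_mod_cast h.symm
        have h4 : b - d = 0 := by exact_mod_cast h'.symm
        rw [sub_eq_zero.1 h3, sub_eq_zero.1 h4] at hdet
        linarith
      obtain ⟨k, hk⟩ := ih (a - c + (b - d) + c + d).toNat (by omega) (a - c) (b - d) c d
        (by omega) (by omega) hc hd ⟨hunit _ (by simp [pairDet]; ring), by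
          simp only [xCoord_add, xCoord_smul]; push_cast; nlinarith, by
          simpa only [yCoord_add, yCoord_smul] using hy, by
          simpa only [xCoord_add, xCoord_smul] using hq3, by
          simpa only [yCoord_add, yCoord_smul] using hq4⟩ rfl
      refine ⟨k + 1, ?_⟩
      have he : (a - c) • p.1 + (b - d) • p.2 + (c • p.1 + d • p.2) = a • p.1 + b • p.2 := by
        module
      rw [Function.iterate_succ_apply', hk, cutForward]
      simp only [he, xCoord_add, xCoord_smul, if_pos hq1]
    by_cases h2 : a ≤ c ∧ b ≤ d
    · have hca : (0 : ℝ) ≤ ((c - a : ℤ) : ℝ) := by exact_mod_cast (by omega : 0 ≤ c - a)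
      have hdb : (0 : ℝ) ≤ ((d - b : ℤ) : ℝ) := by exact_mod_cast (by omega : 0 ≤ d - b)
      have hy : 0 < ((c - a : ℤ) : ℝ) * yCoord φ p.1 + ((d - b : ℤ) : ℝ) * yCoord φ p.2 := by
        rcases hca.lt_or_eq with h | h
        · positivity
        rcases hdb.lt_or_eq with h' | h'
        · positivity
        have h3 : c - a = 0 := by exact_mod_cast h.symm
        have h4 : d - b = 0 := by exact_mod_cast h'.symm
        rw [sub_eq_zero.1 h3, sub_eq_zero.1 h4] at hdet
        linarith
      obtain ⟨k, hk⟩ := ih (a + b + (c - a) + (d - b)).toNat (by omega) a b (c - a) (d - b)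
        ha hb (by omega) (by omega) ⟨hunit _ (by simp [pairDet]; ring), by
          simpa only [xCoord_add, xCoord_smul] using hq1, by
          simpa only [yCoord_add, yCoord_smul] using hq2, by
          simp only [xCoord_add, xCoord_smul]; push_cast; nlinarith, by
          simpa only [yCoord_add, yCoord_smul] using hy⟩ rfl
      refine ⟨k + 1, ?_⟩
      have he : a • p.1 + b • p.2 + ((c - a) • p.1 + (d - b) • p.2) = c • p.1 + d • p.2 := by
        module
      rw [Function.iterate_succ_apply', hk, cutForward]
      simp only [he, xCoord_add, xCoord_smul, if_neg hq3.not_gt]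
    -- Neither vector dominates the other. Positivity of the determinant then forces `c < a` and `b
    -- < d`, so `1 = a * d - b * c ≥ b + c + 1`, and the transition matrix is the identity.
    · refine ⟨0, ?_⟩
      have h3 : c < a ∧ b < d := by
        by_contra h
        have : a ≤ c ∧ d ≤ b := by omega
        nlinarith [mul_nonneg ha (sub_nonneg.2 this.2), mul_nonneg hb (sub_nonneg.2 this.1)]
      have h4 : b + c ≤ 0 := by nlinarith [mul_nonneg hb hc, mul_nonneg (sub_nonneg.2
        (Int.add_one_le_iff.2 h3.1)) hd, mul_nonneg (sub_nonneg.2 (Int.add_one_le_iff.2 h3.2)) hc]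
      have hb0 : b = 0 := by omega
      have hc0 : c = 0 := by omega
      subst hb0 hc0
      have ha1 : a = 1 := by
        rcases Int.eq_one_or_neg_one_of_mul_eq_one (u := a) (v := d) (by linarith) with h | h <;>
          omega
      have hd1 : d = 1 := by subst ha1; linarith
      simp [ha1, hd1]

theorem IsDiag.inFan (hA : IsDiag φ A α β) (hα : 0 < α) (hβ : 0 < β) (hp : InFan φ p) :
    InFan φ (A.1.mulVec p.1, A.1.mulVec p.2) := by
  obtain ⟨hd, h1, h2, h3, h4⟩ := hp
  refine ⟨?_, ?_, ?_, ?_, ?_⟩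
  · have : pairDet (A.1.mulVec p.1, A.1.mulVec p.2) = A.1.det * pairDet p := by
      simp [pairDet, Matrix.mulVec, dotProduct, Matrix.det_fin_two]; ring
    rw [this]
    exact ((Matrix.isUnit_iff_isUnit_det _).1 A.isUnit).mul hd
  · simp only [hA.xCoord_mulVec]; positivity
  · simp only [hA.yCoord_mulVec]; positivity
  · simp only [hA.xCoord_mulVec]; nlinarith
  · simp only [hA.yCoord_mulVec]; positivity

/-- A negative horizontal eigenvalue interchanges the first and second quadrants, hence the roles of
the two vectors. -/
theorem IsDiag.inFan_swap (hA : IsDiag φ A α β) (hα : α < 0) (hβ : 0 < β) (hp : InFan φ p) :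
    InFan φ (A.1.mulVec p.2, A.1.mulVec p.1) := by
  obtain ⟨hd, h1, h2, h3, h4⟩ := hp
  refine ⟨?_, ?_, ?_, ?_, ?_⟩
  · have : pairDet (A.1.mulVec p.2, A.1.mulVec p.1) = -(A.1.det * pairDet p) := by
      simp [pairDet, Matrix.mulVec, dotProduct, Matrix.det_fin_two]; ring
    rw [this]
    exact (((Matrix.isUnit_iff_isUnit_det _).1 A.isUnit).mul hd).neg
  · simp only [hA.xCoord_mulVec]; nlinarith
  · simp only [hA.yCoord_mulVec]; positivity
  · simp only [hA.xCoord_mulVec]; nlinarith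
  · simp only [hA.yCoord_mulVec]; positivity

theorem eventually_nonneg_of_pow (hα : 0 < α) (hα1 : α < 1) (hβ : 1 < β) (c : ℝ) {d : ℝ}
    (hd : 0 < d) : ∀ᶠ m : ℕ in Filter.atTop, 0 ≤ α ^ m * c + β ^ m * d := by
  have h := (tendsto_pow_atTop_atTop_of_one_lt hβ).atTop_mul_const hd
  filter_upwards [h.eventually_ge_atTop |c|] with m hm
  have h1 : α ^ m * |c| ≤ |c| :=
    mul_le_of_le_one_left (abs_nonneg c) (pow_le_one₀ hα.le hα1.le)
  have h2 : -(α ^ m * |c|) ≤ α ^ m * c := by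
    rw [← mul_neg]; exact mul_le_mul_of_nonneg_left (neg_abs_le c) (by positivity)
  linarith

/-- The images of a lattice vector of the upper half-plane under the powers of an automorphism which
contracts horizontally and expands vertically end up in the cone of each basis of the bi-fan. -/
theorem IsDiag.eventually_coords_nonneg (hA : IsDiag φ A α β) (hα : 0 < α) (hα1 : α < 1)
    (hβ : 1 < β) (hp : InFan φ p) {v : Fin 2 → ℤ} (hv : 0 < yCoord φ v) :
    ∀ᶠ m : ℕ in Filter.atTop, ∃ a b : ℤ, 0 ≤ a ∧ 0 ≤ b ∧
      (A ^ m).1.mulVec v = a • p.1 + b • p.2 := by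
  obtain ⟨hd, h1, h2, h3, h4⟩ := hp
  have hdet : 0 < xCoord φ p.1 * yCoord φ p.2 - xCoord φ p.2 * yCoord φ p.1 := by
    nlinarith [mul_pos h1 h4, mul_pos (neg_pos.2 h3) h2]
  -- The two expressions are the Cramer numerators of the coordinates of `A ^ m v` in the basis `p`;
  -- their expanding terms are positive.
  filter_upwards [eventually_nonneg_of_pow hα hα1 hβ (xCoord φ v * yCoord φ p.2)
      (mul_pos (neg_pos.2 h3) hv),
    eventually_nonneg_of_pow hα hα1 hβ (-(xCoord φ v * yCoord φ p.1)) (mul_pos h1 hv)]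
    with m hm1 hm2
  obtain ⟨a, b, hab⟩ := exists_coords hd ((A ^ m).1.mulVec v)
  have hx := (hA.pow m).xCoord_mulVec v
  have hy := (hA.pow m).yCoord_mulVec v
  rw [hab, xCoord_add, xCoord_smul, xCoord_smul] at hx
  rw [hab, yCoord_add, yCoord_smul, yCoord_smul] at hy
  refine ⟨a, b, ?_, ?_, hab⟩
  · have : 0 ≤ (a : ℝ) * (xCoord φ p.1 * yCoord φ p.2 - xCoord φ p.2 * yCoord φ p.1) := by
      refine hm1.trans_eq ?_
      linear_combination (-yCoord φ p.2) * hx + xCoord φ p.2 * hy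
    exact_mod_cast nonneg_of_mul_nonneg_left this hdet
  · have : 0 ≤ (b : ℝ) * (xCoord φ p.1 * yCoord φ p.2 - xCoord φ p.2 * yCoord φ p.1) := by
      refine hm2.trans_eq ?_
      linear_combination yCoord φ p.1 * hx - xCoord φ p.1 * hy
    exact_mod_cast nonneg_of_mul_nonneg_left this hdet

theorem IsDiag.eventually_iterate (hA : IsDiag φ A α β) (hα : 0 < α) (hα1 : α < 1)
    (hβ : 1 < β) (hp : InFan φ p) (hq : InFan φ q) :
    ∀ᶠ m : ℕ in Filter.atTop, ∃ k : ℕ,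
      (cutForward φ)^[k] p = ((A ^ m).1.mulVec q.1, (A ^ m).1.mulVec q.2) := by
  filter_upwards [hA.eventually_coords_nonneg hα hα1 hβ hp hq.2.2.1,
    hA.eventually_coords_nonneg hα hα1 hβ hp hq.2.2.2.2] with m h1 h2
  obtain ⟨a, b, ha, hb, hab⟩ := h1
  obtain ⟨c, d, hc, hd, hcd⟩ := h2
  have h := (hA.pow m).inFan (pow_pos hα m) (pow_pos (zero_lt_one.trans hβ) m) hq
  rw [hab, hcd] at h ⊢
  exact exists_iterate_of_coords_nonneg hp a b c d ha hb hc hd h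

/-- Every element of the bi-fan belongs to the sequence of bases. -/
theorem IsDiag.exists_bases_eq (hA : IsDiag φ A α β) (hα : |α| < 1) (hβ : 1 < |β|)
    (h₀ : InFan φ (e₀, f₀)) (hq : InFan φ q) : ∃ k : ℤ, bases φ e₀ f₀ k = q := by
  have hφ := hA.irrational hα hβ
  have h1 : 0 < α ^ 2 := by have := hA.ne_zero.1; positivity
  have h2 : α ^ 2 < 1 := (sq_lt_one_iff_abs_lt_one α).2 hα
  have h3 : 1 < β ^ 2 := (one_lt_sq_iff_one_lt_abs β).2 hβ
  -- Squaring makes both eigenvalues positive. For a common `m`, the basis `A ^ (2 * m) q` is `k`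
  -- cuts after the initial basis and `l` cuts after `q`, so `q` has index `k - l`.
  obtain ⟨m, ⟨k, hk⟩, l, hl⟩ := (((hA.pow 2).eventually_iterate h1 h2 h3 h₀ hq).and
    ((hA.pow 2).eventually_iterate h1 h2 h3 hq hq)).exists
  refine ⟨k - l, iterate_cutForward_inj hφ (inFan_bases hφ h₀ _) hq l ?_⟩
  rw [← bases_add_nat hφ h₀, hl, ← hk, sub_add_cancel]
  rfl

variable {D G : GeneralLinearGroup (Fin 2) ℤ} {ε ε' : Bool} {k l : ℤ}

/-! ### Symmetries of the cutting sequence -/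

/-- Exchange the two vectors of a pair if `ε` is true. -/
def swapIf (ε : Bool) (p : (Fin 2 → ℤ) × (Fin 2 → ℤ)) : (Fin 2 → ℤ) × (Fin 2 → ℤ) :=
  if ε then p.swap else p

/-- Exchange the symbols `0` and `1` if `ε` is true. -/
def flipIf (ε : Bool) (c : ℤ) : ℤ := if ε then 1 - c else c

/-- An automorphism of the lattice acts on pairs of vectors. -/
def act (A : GeneralLinearGroup (Fin 2) ℤ) (p : (Fin 2 → ℤ) × (Fin 2 → ℤ)) :
    (Fin 2 → ℤ) × (Fin 2 → ℤ) := (A.1.mulVec p.1, A.1.mulVec p.2)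

/-- The step of the cutting algorithm with symbol `c`. -/
def stepWith (c : ℤ) (p : (Fin 2 → ℤ) × (Fin 2 → ℤ)) : (Fin 2 → ℤ) × (Fin 2 → ℤ) :=
  if c = 0 then (p.1, p.1 + p.2) else (p.1 + p.2, p.2)

theorem swapIf_swapIf (ε ε' : Bool) (p) : swapIf ε (swapIf ε' p) = swapIf (ε ^^ ε') p := by
  cases ε <;> cases ε' <;> simp [swapIf]

theorem flipIf_flipIf (ε ε' : Bool) (c) : flipIf ε (flipIf ε' c) = flipIf (ε ^^ ε') c := by
  cases ε <;> cases ε' <;> simp [flipIf]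

theorem flipIf_left_inj {c : ℤ} (h : flipIf ε c = flipIf ε' c) : ε = ε' := by
  cases ε <;> cases ε' <;> simp [flipIf] at h ⊢ <;> omega

theorem act_swapIf (A) (ε : Bool) (p) : act A (swapIf ε p) = swapIf ε (act A p) := by
  cases ε <;> simp [swapIf, act]

theorem act_mul (A B) (p) : act (A * B) p = act A (act B p) := by
  simp only [act, Units.val_mul, Matrix.mulVec_mulVec]

theorem act_one (p) : act 1 p = p := by simp [act]

theorem act_stepWith (A) (c : ℤ) (p) : act A (stepWith c p) = stepWith c (act A p) := by
  unfold stepWith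
  split_ifs <;> simp [act, Matrix.mulVec_add]

theorem swapIf_stepWith {c : ℤ} (hc : c = 0 ∨ c = 1) (ε : Bool) (p) :
    swapIf ε (stepWith c p) = stepWith (flipIf ε c) (swapIf ε p) := by
  rcases hc with rfl | rfl <;> cases ε <;> simp [swapIf, flipIf, stepWith, add_comm]

theorem stepWith_injective (c : ℤ) : Function.Injective (stepWith c) := by
  intro p q h
  unfold stepWith at h
  split_ifs at h <;> simp only [Prod.mk.injEq] at h
  · exact Prod.ext h.1 (by simpa [h.1] using h.2)
  · exact Prod.ext (by simpa [h.2] using h.1) h.2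

theorem act_left_inj (hp : IsUnit (pairDet p)) (h : act A p = act B p) : A = B := GL_ext fun v => by
  obtain ⟨a, b, rfl⟩ := exists_coords hp v
  simp only [act, Prod.mk.injEq] at h
  simp only [Matrix.mulVec_add, Matrix.mulVec_smul, h.1, h.2]

/-- The matrix with columns `p.1`, `p.2`. -/
def ofPair (p : (Fin 2 → ℤ) × (Fin 2 → ℤ)) : Matrix (Fin 2) (Fin 2) ℤ :=
  !![p.1 0, p.2 0; p.1 1, p.2 1]

theorem exists_act_eq (hp : IsUnit (pairDet p)) (hq : IsUnit (pairDet q)) :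
    ∃ A, act A p = q := by
  have key : ∀ p, IsUnit (pairDet p) → ∃ M : GeneralLinearGroup (Fin 2) ℤ,
      act M (![1, 0], ![0, 1]) = p := fun p hp => by
    have hu : IsUnit (ofPair p) := by
      rw [Matrix.isUnit_iff_isUnit_det, ofPair, Matrix.det_fin_two_of]
      rwa [pairDet, mul_comm (p.1 1)] at hp
    refine ⟨hu.unit, ?_⟩
    refine Prod.ext (funext fun i => ?_) (funext fun i => ?_) <;> fin_cases i <;>
      simp [act, ofPair]
  obtain ⟨M, hM⟩ := key p hp
  obtain ⟨N, hN⟩ := key q hq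
  refine ⟨N * M⁻¹, ?_⟩
  rw [act_mul, ← hM, ← act_mul M⁻¹, inv_mul_cancel, act_one, hN]

theorem cuttingSeq_eq_zero_or_one (n : ℤ) :
    cuttingSeq φ e₀ f₀ n = 0 ∨ cuttingSeq φ e₀ f₀ n = 1 := by
  unfold cuttingSeq; split_ifs <;> simp

theorem flipIf_cuttingSeq (ε : Bool) (n : ℤ) :
    flipIf ε (cuttingSeq φ e₀ f₀ n) = 0 ∨ flipIf ε (cuttingSeq φ e₀ f₀ n) = 1 := by
  rcases cuttingSeq_eq_zero_or_one (φ := φ) (e₀ := e₀) (f₀ := f₀) n with h | h <;>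
    cases ε <;> simp [flipIf, h]

/-- Since `p.2 ≠ 0`, the sum differs from `p.1`, so the symbol records which branch was taken. -/
theorem cutForward_eq_stepWith (hp : InFan φ p) :
    cutForward φ p = stepWith (if (cutForward φ p).1 = p.1 then 0 else 1) p := by
  have hne : p.2 ≠ 0 := fun h => by
    have := hp.2.2.2.2
    rw [h, yCoord_zero] at this
    exact this.false
  unfold cutForward stepWith
  split_ifs with h1 h2 h3 h4 h5 <;> simp_all

theorem bases_succ_eq_stepWith (hφ : Irrational φ) (h₀ : InFan φ (e₀, f₀)) (n : ℤ) :
    bases φ e₀ f₀ (n + 1) = stepWith (cuttingSeq φ e₀ f₀ n) (bases φ e₀ f₀ n) := by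
  unfold cuttingSeq
  rw [bases_succ hφ h₀]
  exact cutForward_eq_stepWith (inFan_bases hφ h₀ n)

theorem stepWith_left_inj {c d : ℤ} (hp : InFan φ p) (hc : c = 0 ∨ c = 1) (hd : d = 0 ∨ d = 1)
    (h : stepWith c p = stepWith d p) : c = d := by
  have hne : p.2 ≠ 0 := fun h => by
    have := hp.2.2.2.2
    rw [h, yCoord_zero] at this
    exact this.false
  rcases hc with rfl | rfl <;> rcases hd with rfl | rfl <;> simp_all [stepWith]

/-- `A` shifts the sequence of bases by `k`, exchanging the two vectors if `ε` is true. -/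
def Shifts (φ : (Fin 2 → ℝ) ≃ₗ[ℝ] ℝ × ℝ) (e₀ f₀ : Fin 2 → ℤ)
    (A : GeneralLinearGroup (Fin 2) ℤ) (ε : Bool) (k : ℤ) : Prop :=
  ∀ j, act A (bases φ e₀ f₀ j) = swapIf ε (bases φ e₀ f₀ (j + k))

/-- Shifting the cutting sequence by `k` leaves it unchanged, up to exchange of the symbols. -/
def SeqShifts (s : ℤ → ℤ) (ε : Bool) (k : ℤ) : Prop := ∀ j, s (j + k) = flipIf ε (s j)

theorem Shifts.mul (hA : Shifts φ e₀ f₀ A ε k) (hB : Shifts φ e₀ f₀ B ε' l) :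
    Shifts φ e₀ f₀ (A * B) (ε' ^^ ε) (k + l) := fun j => by
  rw [act_mul, hB, act_swapIf, hA, swapIf_swapIf]
  congr 2; ring

theorem shifts_one : Shifts φ e₀ f₀ 1 false 0 := fun j => by simp [act_one, swapIf]

theorem Shifts.inv (hA : Shifts φ e₀ f₀ A ε k) : Shifts φ e₀ f₀ A⁻¹ ε (-k) := fun j => by
  have h := hA (j + -k)
  rw [neg_add_cancel_right] at h
  have h' := congrArg (fun p => act A⁻¹ (swapIf ε p)) h
  simp only [swapIf_swapIf, Bool.xor_self, ← act_swapIf, ← act_mul, inv_mul_cancel, act_one] at h'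
  rw [h']
  simp [swapIf]

theorem Shifts.zpow (hA : Shifts φ e₀ f₀ A ε k) (n : ℤ) :
    ∃ ε', Shifts φ e₀ f₀ (A ^ n) ε' (n * k) := by
  induction n using Int.induction_on with
  | zero => exact ⟨false, by simpa using shifts_one⟩
  | succ n ih =>
    obtain ⟨ε', h⟩ := ih
    exact ⟨_, by simpa only [_root_.zpow_add_one, add_one_mul] using h.mul hA⟩
  | pred n ih =>
    obtain ⟨ε', h⟩ := ih
    exact ⟨_, by simpa only [_root_.zpow_sub_one, sub_one_mul, ← sub_eq_add_neg] using h.mul hA.inv⟩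

/-- Steps with a given symbol commute with linear maps, and exchanging the two vectors exchanges the
symbols. -/
theorem Shifts.seqShifts (hφ : Irrational φ) (h₀ : InFan φ (e₀, f₀))
    (hA : Shifts φ e₀ f₀ A ε k) : SeqShifts (cuttingSeq φ e₀ f₀) ε k := fun j => by
  have h := hA (j + 1)
  rw [bases_succ_eq_stepWith hφ h₀, act_stepWith, hA,
    (by ring : j + 1 + k = j + k + 1), bases_succ_eq_stepWith hφ h₀] at h
  have h' := congrArg (swapIf ε) h
  rw [swapIf_stepWith (cuttingSeq_eq_zero_or_one _)] at h'
  simp only [swapIf_swapIf, Bool.xor_self] at h'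
  exact (stepWith_left_inj (inFan_bases hφ h₀ (j + k)) (flipIf_cuttingSeq ε j)
    (cuttingSeq_eq_zero_or_one _) (by simpa [swapIf] using h')).symm

/-- One basis and the symbols determine all the bases, backward as well because `stepWith` is
injective; agreement at index `0` therefore propagates. -/
theorem SeqShifts.shifts (hφ : Irrational φ) (h₀ : InFan φ (e₀, f₀))
    (hs : SeqShifts (cuttingSeq φ e₀ f₀) ε k)
    (hA : act A (e₀, f₀) = swapIf ε (bases φ e₀ f₀ k)) : Shifts φ e₀ f₀ A ε k := by
  have key : ∀ j, stepWith (cuttingSeq φ e₀ f₀ j) (swapIf ε (bases φ e₀ f₀ (j + k))) =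
      swapIf ε (bases φ e₀ f₀ (j + 1 + k)) := fun j => by
    rw [(by ring : j + 1 + k = j + k + 1), bases_succ_eq_stepWith hφ h₀ (j + k),
      swapIf_stepWith (cuttingSeq_eq_zero_or_one _), hs, flipIf_flipIf]
    simp [flipIf]
  intro j
  induction j using Int.induction_on with
  | zero => simpa [bases_zero] using hA
  | succ n ih => rw [bases_succ_eq_stepWith hφ h₀, act_stepWith, ih, key]
  | pred n ih =>
    refine stepWith_injective (cuttingSeq φ e₀ f₀ (-n - 1)) ?_
    rw [key, ← act_stepWith, ← bases_succ_eq_stepWith hφ h₀, sub_add_cancel, ih]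

/-- A symbol cannot be both kept and flipped, so `k` determines whether the vectors are exchanged,
and then the image of the initial basis. -/
theorem Shifts.unique (hφ : Irrational φ) (h₀ : InFan φ (e₀, f₀)) (hA : Shifts φ e₀ f₀ A ε k)
    (hB : Shifts φ e₀ f₀ B ε' k) : A = B := by
  have h : ε = ε' := flipIf_left_inj
    ((hA.seqShifts hφ h₀ 0).symm.trans (hB.seqShifts hφ h₀ 0))
  subst h
  exact act_left_inj h₀.1 ((hA 0).trans (hB 0).symm)

theorem cutForward_act (hA : IsDiag φ A α β) (hα : 0 < α) (p) :
    cutForward φ (act A p) = act A (cutForward φ p) := by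
  have : 0 < xCoord φ ((act A p).1 + (act A p).2) ↔ 0 < xCoord φ (p.1 + p.2) := by
    simp only [act]
    rw [← Matrix.mulVec_add, hA.xCoord_mulVec]
    exact mul_pos_iff_of_pos_left hα
  unfold cutForward
  simp only [this]
  split_ifs <;> simp [act, Matrix.mulVec_add]

/-- The sum changes sides of the vertical axis, so the opposite branch is taken, as the exchange of
the vectors requires. -/
theorem cutForward_swap_act (hφ : Irrational φ) (hA : IsDiag φ A α β) (hα : α < 0)
    (hp : InFan φ p) : cutForward φ (act A p).swap = (act A (cutForward φ p)).swap := by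
  have hne : xCoord φ (p.1 + p.2) ≠ 0 := fun h => by
    have := hp.2.2.1
    have h' := hp.2.2.2.2
    have h'' := congrArg (yCoord φ) (hφ.1 _ h)
    rw [yCoord_add, yCoord_zero] at h''
    linarith
  have : 0 < xCoord φ ((act A p).swap.1 + (act A p).swap.2) ↔ ¬ 0 < xCoord φ (p.1 + p.2) := by
    simp only [act, Prod.swap]
    rw [← Matrix.mulVec_add, hA.xCoord_mulVec, add_comm, ← neg_mul_neg,
      mul_pos_iff_of_pos_left (neg_pos.2 hα), neg_pos, not_lt]
    exact ⟨le_of_lt, fun h => lt_of_le_of_ne h hne⟩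
  unfold cutForward
  simp only [this]
  split_ifs <;> simp_all [act, Matrix.mulVec_add, add_comm]

/-- A bijection commuting with the cutting algorithm shifts the whole sequence as soon as it
shifts the initial basis. -/
theorem bases_eq_of_semiconj (hφ : Irrational φ) (h₀ : InFan φ (e₀, f₀))
    {F : (Fin 2 → ℤ) × (Fin 2 → ℤ) → (Fin 2 → ℤ) × (Fin 2 → ℤ)}
    (hF : ∀ p, InFan φ p → InFan φ (F p))
    (hF' : ∀ p, InFan φ p → cutForward φ (F p) = F (cutForward φ p))
    (hk : bases φ e₀ f₀ k = F (e₀, f₀)) (j : ℤ) :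
    F (bases φ e₀ f₀ j) = bases φ e₀ f₀ (j + k) := by
  induction j using Int.induction_on with
  | zero => simpa [bases_zero] using hk.symm
  | succ n ih =>
    rw [bases_succ hφ h₀, ← hF' _ (inFan_bases hφ h₀ _), ih, ← bases_succ hφ h₀]
    congr 1; ring
  | pred n ih =>
    refine cutForward_inj (hF _ (inFan_bases hφ h₀ _)) (inFan_bases hφ h₀ _) ?_
    rw [hF' _ (inFan_bases hφ h₀ _), ← bases_succ hφ h₀, ← bases_succ hφ h₀, sub_add_cancel, ih]
    congr 1; ring

/-- A diagonal automorphism preserving the upper half-plane shifts the sequence of bases. -/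
theorem IsDiag.exists_shifts (hD : IsDiag φ D α β) (hα : |α| < 1) (hβ : 1 < |β|)
    (h₀ : InFan φ (e₀, f₀)) (hA : IsDiag φ A γ δ) (hδ : 0 < δ) :
    ∃ ε k, Shifts φ e₀ f₀ A ε k := by
  have hφ := hD.irrational hα hβ
  rcases hA.ne_zero.1.lt_or_gt with hγ | hγ
  · obtain ⟨k, hk⟩ := hD.exists_bases_eq hα hβ h₀ (hA.inFan_swap hγ hδ h₀)
    refine ⟨true, k, fun j => ?_⟩
    have := bases_eq_of_semiconj hφ h₀ (F := fun p => (act A p).swap)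
      (fun p hp => hA.inFan_swap hγ hδ hp) (fun p hp => cutForward_swap_act hφ hA hγ hp) hk j
    rw [← this]
    simp [swapIf]
  · obtain ⟨k, hk⟩ := hD.exists_bases_eq hα hβ h₀ (hA.inFan hγ hδ h₀)
    refine ⟨false, k, fun j => ?_⟩
    exact bases_eq_of_semiconj hφ h₀ (F := act A)
      (fun p hp => hA.inFan hγ hδ hp) (fun p hp => cutForward_act hA hγ p) hk j

theorem Shifts.yCoord_sum (hA : Shifts φ e₀ f₀ A ε k) :
    yCoord φ (A.1.mulVec e₀) + yCoord φ (A.1.mulVec f₀) =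
      yCoord φ (bases φ e₀ f₀ k).1 + yCoord φ (bases φ e₀ f₀ k).2 := by
  have h := hA 0
  rw [zero_add, bases_zero] at h
  cases ε <;> simp only [act, swapIf, Prod.ext_iff] at h <;> simp at h <;>
    simp [h.1, h.2, add_comm]

/-- An automorphism expanding the vertical direction moves the sequence of bases forward. -/
theorem Shifts.pos (hφ : Irrational φ) (h₀ : InFan φ (e₀, f₀)) (hA : Shifts φ e₀ f₀ A ε k)
    (hd : IsDiag φ A α β) (hβ : 1 < β) : 0 < k := by
  rw [← (strictMono_height hφ h₀).lt_iff_lt]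
  have h2 := h₀.2.2.1
  have h4 := h₀.2.2.2.2
  simp only [← hA.yCoord_sum, bases_zero, hd.yCoord_mulVec] at *
  nlinarith

/-- An automorphism shifting the sequence of bases is diagonal. -/
theorem Shifts.isDiag (hD : IsDiag φ D α β) (hα : |α| < 1) (hβ : 1 < |β|)
    (h₀ : InFan φ (e₀, f₀)) (hA : Shifts φ e₀ f₀ A ε k) :
    ∃ γ δ, IsDiag φ A γ δ ∧ 0 < δ := by
  have hφ := hD.irrational hα hβ
  have h2 : α ^ 2 < 1 := (sq_lt_one_iff_abs_lt_one α).2 hα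
  have h3 : 1 < β ^ 2 := (one_lt_sq_iff_one_lt_abs β).2 hβ
  obtain ⟨ε', l, hP⟩ := hD.exists_shifts hα hβ h₀ (hD.pow 2) (zero_lt_one.trans h3)
  -- Both products shift by the same total amount. The square is used because `D` itself may reverse
  -- the vertical direction.
  have hc : D ^ 2 * A = A * D ^ 2 :=
    Shifts.unique hφ h₀ (hP.mul hA) (by rw [add_comm]; exact hA.mul hP)
  obtain ⟨γ, δ, h⟩ := (hD.pow 2).of_commute (h2.trans h3).ne hc
  refine ⟨γ, δ, h, ?_⟩
  have hs := hA.yCoord_sum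
  rw [h.yCoord_mulVec, h.yCoord_mulVec, ← mul_add] at hs
  have h5 := inFan_bases hφ h₀ k
  have : 0 < δ * (yCoord φ e₀ + yCoord φ f₀) := by
    rw [hs]; exact add_pos h5.2.2.1 h5.2.2.2.2
  exact (pos_iff_pos_of_mul_pos this).2 (add_pos h₀.2.2.1 h₀.2.2.2.2)

/-! ### Periods and semi-periods -/

variable {s : ℤ → ℤ}

theorem SeqShifts.add (h : SeqShifts s ε k) (h' : SeqShifts s ε' l) :
    SeqShifts s (ε' ^^ ε) (k + l) := fun j => by
  rw [← add_assoc, h', h, flipIf_flipIf]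

theorem SeqShifts.neg (h : SeqShifts s ε k) : SeqShifts s ε (-k) := fun j => by
  have := h (j + -k)
  rw [neg_add_cancel_right] at this
  rw [this, flipIf_flipIf]
  simp [flipIf]

/-- The shifts which leave the sequence unchanged up to exchange of the symbols. -/
def seqShiftGroup (s : ℤ → ℤ) : AddSubgroup ℤ where
  carrier := {k | ∃ ε, SeqShifts s ε k}
  add_mem' := fun ⟨_, h⟩ ⟨_, h'⟩ => ⟨_, h.add h'⟩
  zero_mem' := ⟨false, fun j => by simp [flipIf]⟩
  neg_mem' := fun ⟨_, h⟩ => ⟨_, h.neg⟩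

theorem isPeriod_iff {n : ℕ} : IsPeriod s n ↔ 0 < n ∧ SeqShifts s false n := by
  simp [IsPeriod, SeqShifts, flipIf]

theorem isSemiPeriod_iff {n : ℕ} : IsSemiPeriod s n ↔ 0 < n ∧ SeqShifts s true n := by
  simp [IsSemiPeriod, SeqShifts, flipIf]

theorem dvd_of_forall_lt {H : AddSubgroup ℤ} {n : ℕ} (hn : 0 < n) (hm : (n : ℤ) ∈ H)
    (h : ∀ r : ℕ, 0 < r → r < n → (r : ℤ) ∉ H) {k : ℤ} (hk : k ∈ H) : (n : ℤ) ∣ k := by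
  have hn' : (n : ℤ) ≠ 0 := by omega
  by_contra hd
  have h0 := Int.emod_nonneg k hn'
  have h1 := Int.emod_lt_of_pos k (by omega : (0 : ℤ) < n)
  have h2 : k % n ≠ 0 := fun h => hd (Int.dvd_of_emod_eq_zero h)
  refine h (k % n).toNat (by omega) (by omega) ?_
  rw [Int.toNat_of_nonneg h0, Int.emod_def]
  refine H.sub_mem hk ?_
  rw [mul_comm, ← smul_eq_mul]
  exact H.zsmul_mem hm _

theorem IsBasicSemiPeriod.dvd {n : ℕ} (hn : IsBasicSemiPeriod s n) (hk : k ∈ seqShiftGroup s) :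
    (n : ℤ) ∣ k := by
  obtain ⟨h0, h⟩ := isSemiPeriod_iff.1 hn.1
  refine dvd_of_forall_lt (H := seqShiftGroup s) h0 ⟨_, h⟩ ?_ hk
  rintro r hr hrn ⟨ε, hε⟩
  cases ε with
  | true => exact hrn.not_ge (hn.2 (isSemiPeriod_iff.2 ⟨hr, hε⟩))
  | false =>
    -- A period `r` smaller than the semi-period `n` would make `n - r` a smaller semi-period.
    have h' : SeqShifts s true ((n - r : ℕ) : ℤ) := by
      have := h.add hε.neg
      simpa [Nat.cast_sub hrn.le, sub_eq_add_neg] using this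
    have := hn.2 (isSemiPeriod_iff.2 ⟨by omega, h'⟩)
    omega

theorem IsBasicPeriod.dvd {n : ℕ} (hn : IsBasicPeriod s n) (hs : ¬ ∃ m, IsSemiPeriod s m)
    (hk : k ∈ seqShiftGroup s) : (n : ℤ) ∣ k := by
  obtain ⟨h0, h⟩ := isPeriod_iff.1 hn.1
  refine dvd_of_forall_lt (H := seqShiftGroup s) h0 ⟨_, h⟩ ?_ hk
  rintro r hr hrn ⟨ε, hε⟩
  cases ε with
  | true => exact hs ⟨r, isSemiPeriod_iff.2 ⟨hr, hε⟩⟩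
  | false => exact hrn.not_ge (hn.2 (isPeriod_iff.2 ⟨hr, hε⟩))

/-! ### The centralizer -/

/-- Up to sign, each diagonal automorphism is a power of an automorphism which realizes the
smallest shift. -/
theorem Shifts.eq_zpow_of_isDiag {n : ℕ} (hD : IsDiag φ D α β) (hα : |α| < 1) (hβ : 1 < |β|)
    (h₀ : InFan φ (e₀, f₀)) (hG : Shifts φ e₀ f₀ G ε n)
    (hdvd : ∀ k ∈ seqShiftGroup (cuttingSeq φ e₀ f₀), (n : ℤ) ∣ k)
    (hA : IsDiag φ A γ δ) (hδ : 0 < δ) :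
    ∃ k : ℤ, A = G ^ k ∧ ∃ ε', Shifts φ e₀ f₀ A ε' (k * n) := by
  have hφ := hD.irrational hα hβ
  obtain ⟨ε', k, hk⟩ := hD.exists_shifts hα hβ h₀ hA hδ
  obtain ⟨l, rfl⟩ := hdvd k ⟨ε', hk.seqShifts hφ h₀⟩
  obtain ⟨ε'', hl⟩ := hG.zpow l
  rw [mul_comm] at hk
  exact ⟨l, hk.unique hφ h₀ hl, ε', hk⟩

theorem Shifts.isGeneratorOf {n : ℕ} (hD : IsDiag φ D α β) (hα : |α| < 1) (hβ : 1 < |β|)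
    (h₀ : InFan φ (e₀, f₀)) (hG : Shifts φ e₀ f₀ G ε n)
    (hdvd : ∀ k ∈ seqShiftGroup (cuttingSeq φ e₀ f₀), (n : ℤ) ∣ k) : IsGeneratorOf φ D G := by
  have hφ := hD.irrational hα hβ
  obtain ⟨γ, δ, hGd, -⟩ := hG.isDiag hD hα hβ h₀
  refine ⟨hGd.preservesAxes, ?_, ?_⟩
  -- To be applied to whichever of `D` and `-D` has vertical eigenvalue greater than `1`; such a map
  -- shifts forward, so its exponent is positive.
  · have key : ∀ D' α' β', IsDiag φ D' α' β' → 1 < β' → ∃ K : ℕ, 0 < K ∧ G ^ K = D' := by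
      intro D' α' β' hD' hβ'
      obtain ⟨k, hk, ε', hs⟩ := hG.eq_zpow_of_isDiag hD hα hβ h₀ hdvd hD' (zero_lt_one.trans hβ')
      have hk0 : 0 < k := pos_of_mul_pos_left (hs.pos hφ h₀ hD' hβ') (by positivity)
      refine ⟨k.toNat, by omega, ?_⟩
      rw [hk, ← zpow_natCast, Int.toNat_of_nonneg hk0.le]
    rcases lt_abs.1 hβ with h | h
    · obtain ⟨K, hK, h⟩ := key _ _ _ hD h
      exact ⟨K, hK, Or.inl h⟩
    · obtain ⟨K, hK, h⟩ := key _ _ _ hD.neg h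
      exact ⟨K, hK, Or.inr h⟩
  · ext A
    simp only [SetLike.mem_coe, Subgroup.mem_centralizer_singleton_iff, Set.mem_ofPred_eq]
    constructor
    · intro h
      have hne : α ≠ β := fun h => by rw [h] at hα; exact (hα.trans hβ).false
      obtain ⟨a, b, hA⟩ := hD.of_commute hne h.symm
      rcases hA.ne_zero.2.lt_or_gt with hb | hb
      · obtain ⟨k, hk, -⟩ := hG.eq_zpow_of_isDiag hD hα hβ h₀ hdvd hA.neg (neg_pos.2 hb)
        exact ⟨k, Or.inr (by rw [← hk, neg_neg])⟩
      · obtain ⟨k, hk, -⟩ := hG.eq_zpow_of_isDiag hD hα hβ h₀ hdvd hA hb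
        exact ⟨k, Or.inl hk⟩
    · have hc : Commute D G := hD.commute hφ hGd
      rintro ⟨k, rfl | rfl⟩
      · exact (hc.zpow_right k).eq.symm
      · rw [mul_neg, neg_mul]
        rw [(hc.zpow_right k).eq]

theorem exists_isGeneratorOf {n : ℕ} (hD : IsDiag φ D α β) (hα : |α| < 1) (hβ : 1 < |β|)
    (h₀ : InFan φ (e₀, f₀)) (hs : SeqShifts (cuttingSeq φ e₀ f₀) ε n)
    (hdvd : ∀ k ∈ seqShiftGroup (cuttingSeq φ e₀ f₀), (n : ℤ) ∣ k) :
    ∃ G, (∀ A, act A (e₀, f₀) = swapIf ε (bases φ e₀ f₀ n) ↔ A = G) ∧ IsGeneratorOf φ D G := by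
  have hφ := hD.irrational hα hβ
  have hu : IsUnit (pairDet (swapIf ε (bases φ e₀ f₀ n))) := by
    have h := (inFan_bases hφ h₀ n).1
    cases ε with
    | false => exact h
    | true =>
      rw [← IsUnit.neg_iff]
      convert h using 1
      simp [pairDet, swapIf]; ring
  obtain ⟨G, hG⟩ := exists_act_eq h₀.1 hu
  exact ⟨G, fun A => ⟨fun h => act_left_inj h₀.1 (h.trans hG.symm), fun h => h ▸ hG⟩,
    (hs.shifts hφ h₀ hG).isGeneratorOf hD hα hβ h₀ hdvd⟩

theorem exists_isBasicPeriod (hD : IsDiag φ D α β) (hα : |α| < 1) (hβ : 1 < |β|)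
    (h₀ : InFan φ (e₀, f₀)) : ∃ n, IsBasicPeriod (cuttingSeq φ e₀ f₀) n := by
  classical
  have hφ := hD.irrational hα hβ
  have h3 : 1 < β ^ 2 := (one_lt_sq_iff_one_lt_abs β).2 hβ
  obtain ⟨ε, k, hk⟩ := hD.exists_shifts hα hβ h₀ (hD.pow 2) (zero_lt_one.trans h3)
  have hpos := hk.pos hφ h₀ (hD.pow 2) h3
  -- Doubling the shift cancels a possible exchange of symbols, which leaves a genuine period.
  have hs := (hk.seqShifts hφ h₀).add (hk.seqShifts hφ h₀)
  have hex : ∃ n, IsPeriod (cuttingSeq φ e₀ f₀) n := ⟨(k + k).toNat, isPeriod_iff.2 ⟨by omega, by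
    rw [Int.toNat_of_nonneg (by omega)]; simpa using hs⟩⟩
  exact ⟨Nat.find hex, Nat.find_spec hex, fun m hm => Nat.find_min' hex hm⟩

end ToralBiFan

theorem mainTheorem3 (D : Matrix.GeneralLinearGroup (Fin 2) ℤ) (hD : ToralBiFan.IsHyperbolic D)
    (φ : (Fin 2 → ℝ) ≃ₗ[ℝ] ℝ × ℝ) (hφ : ToralBiFan.IsAdapted D φ)
    (e₀ f₀ : Fin 2 → ℤ) (h₀ : ToralBiFan.MemBiFan φ e₀ f₀) :
    -- the cutting sequence is periodic, so that the basic period makes sense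
    (∃ N : ℕ, ToralBiFan.IsBasicPeriod (ToralBiFan.cuttingSeq φ e₀ f₀) N) ∧
    -- the case of the semi-period: `e₀ ↦ f_N`, `f₀ ↦ e_N` defines a unique automorphism `G`
    (∀ N : ℕ, ToralBiFan.IsBasicSemiPeriod (ToralBiFan.cuttingSeq φ e₀ f₀) N →
      ∃ G : Matrix.GeneralLinearGroup (Fin 2) ℤ,
        (∀ A : Matrix.GeneralLinearGroup (Fin 2) ℤ,
          (A.1.mulVec e₀ = (ToralBiFan.bases φ e₀ f₀ N).2 ∧
            A.1.mulVec f₀ = (ToralBiFan.bases φ e₀ f₀ N).1) ↔ A = G) ∧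
        ToralBiFan.IsGeneratorOf φ D G) ∧
    -- the case of the period, when there is no semi-period: `e₀ ↦ e_N`, `f₀ ↦ f_N`
    ((¬ ∃ M : ℕ, ToralBiFan.IsSemiPeriod (ToralBiFan.cuttingSeq φ e₀ f₀) M) →
      ∀ N : ℕ, ToralBiFan.IsBasicPeriod (ToralBiFan.cuttingSeq φ e₀ f₀) N →
      ∃ G : Matrix.GeneralLinearGroup (Fin 2) ℤ,
        (∀ A : Matrix.GeneralLinearGroup (Fin 2) ℤ,
          (A.1.mulVec e₀ = (ToralBiFan.bases φ e₀ f₀ N).1 ∧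
            A.1.mulVec f₀ = (ToralBiFan.bases φ e₀ f₀ N).2) ↔ A = G) ∧
        ToralBiFan.IsGeneratorOf φ D G) := by
  obtain ⟨α, β, hα, hβ, hd⟩ := hφ
  have hd : ToralBiFan.IsDiag φ D α β := hd
  have hf := h₀.inFan
  refine ⟨ToralBiFan.exists_isBasicPeriod hd hα hβ hf, fun N hN => ?_, fun hsemi N hN => ?_⟩
  · obtain ⟨G, hG, hgen⟩ := ToralBiFan.exists_isGeneratorOf hd hα hβ hf
      (ToralBiFan.isSemiPeriod_iff.1 hN.1).2 fun _ hk => hN.dvd hk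
    exact ⟨G, fun A => by rw [← hG A]; simp [ToralBiFan.act, ToralBiFan.swapIf, Prod.ext_iff], hgen⟩
  · obtain ⟨G, hG, hgen⟩ := ToralBiFan.exists_isGeneratorOf hd hα hβ hf
      (ToralBiFan.isPeriod_iff.1 hN.1).2 fun _ hk => hN.dvd hsemi hk
    exact ⟨G, fun A => by rw [← hG A]; simp [ToralBiFan.act, ToralBiFan.swapIf, Prod.ext_iff], hgen⟩
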